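/- Write $q=e^{\pi i\tau}$, $\theta_3(\tau)=\sum_{n\in\mathbb Z}q^{n^2}$, $\theta_2(\tau)=\sum_{n\in\mathbb Z}q^{(n-1/2)^2}$ for $\operatorname{Im}\tau>0$. Let $l\ge 1$ be odd, $k=2l$, $A=\frac{l+1}{2}$ and $m\in\mathbb Z$. For an integer $h$ coprime to $k$ choose an integer $h'$ with $hh'\equiv-1\pmod k$ and put $$\gamma=\begin{pmatrix}h' & -\frac{hh'+1}{l}\\ l&-h\end{pmatrix}\in SL_2(\mathbb Z).$$ Then there is exactly one number $\kappa(\gamma^{-1})\in\mathbb C$ such that, writing $\gamma^{-1}=\begin{pmatrix}a&b\\c&d\end{pmatrix}$ (so $c=-l$, $d=h'$), $$\theta_3\!\left(\frac{a\tau+b}{c\tau+d}\right)=\kappa(\gamma^{-1})\,\frac{(c\tau+d)^{1/2}}{i^{1/2}}\,\theta_2(\tau)\qquad(\operatorname{Im}\tau>0),$$ with principal square roots. Let $$A_k(m)=-\sum_{\substack{h \bmod k\\ (h,k)=1}}\kappa(\gamma^{-1})^2\,e^{-2\pi i\left(\frac{h'}{2k}+\frac{mh}{k}\right)} .$$ Then,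 for every choice of the representatives $h$ and of the $h'$, $$A_k(m)=(-1)^{(l-1)/2}(-1)^{m-1}\,T(-2mA^2,A^2,l),$$ where $T$ is the Kloosterman sum $T(a,b,l)=\sum_{h \bmod l,\ (h,l)=1}e^{\frac{2\pi i}{l}(ah+b\bar h)}$, $h\bar h\equiv1\pmod l$. -/

import Mathlib

open scoped MatrixGroups

/-- The theta constant `θ₂(τ) = ∑_{n ∈ ℤ} q^{(n - 1/2)²}`, with `q = e^{π i τ}`.
(The theta constant `θ₃(τ) = ∑_{n ∈ ℤ} q^{n²}` is Mathlib's `jacobiTheta`.) -/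
noncomputable def thetaTwo (τ : ℂ) : ℂ :=
  ∑' n : ℤ, Complex.exp (Real.pi * Complex.I * ((n : ℂ) - 1 / 2) ^ 2 * τ)

/-- `κ` is a multiplier of `θ₃` under `M = (a b; c d)`, for `M` taking `θ₃` to `θ₂`:
`θ₃(M τ) = κ ((c τ + d) / i)^{1/2} θ₂(τ)` on the upper half-plane. The square root is the
holomorphic branch `(c τ + d)^{1/2} / i^{1/2}`, with principal roots (the other branch
replaces `κ` by `-κ`, so `κ²` does not depend on this choice). -/
def IsThetaMultiplier (M : SL(2, ℤ)) (κ : ℂ) : Prop :=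
  ∀ τ : UpperHalfPlane,
    jacobiTheta ((M • τ : UpperHalfPlane) : ℂ) =
      κ * ((((M 1 0 : ℤ) : ℂ) * (τ : ℂ) + ((M 1 1 : ℤ) : ℂ)) ^ (1 / 2 : ℂ)
          / Complex.I ^ (1 / 2 : ℂ))
        * thetaTwo (τ : ℂ)

/-- The theta multiplier `κ(M)`: the number with the property `IsThetaMultiplier M`. -/
noncomputable def thetaMultiplier (M : SL(2, ℤ)) : ℂ :=
  Classical.epsilon (IsThetaMultiplier M)

/-- For `k = 2 l` and `h h' ≡ -1 (mod k)`, the modular transformation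
`γ = (h', -(h h' + 1) / l; l, -h)`, which takes the cusp `h / l` to `∞`. In the variable
`z = τ / 2` it is `(h', -(h h' + 1) / k; k, -h)`. -/
def cuspMatrix (l : ℕ) (h h' : ℤ) (hh : ((2 * l : ℕ) : ℤ) ∣ h * h' + 1) : SL(2, ℤ) :=
  ⟨!![h', -((h * h' + 1) / l); (l : ℤ), -h], by
    have hl : (l : ℤ) ∣ h * h' + 1 :=
      dvd_trans ⟨2, by push_cast; ring⟩ hh
    have key : (h * h' + 1) / (l : ℤ) * l = h * h' + 1 := Int.ediv_mul_cancel hl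
    rw [Matrix.det_fin_two_of]
    linarith⟩

/-- The arithmetic factor for `r = 2` and `k = 2 l`:
`A_k(m) = -∑_{(h, k) = 1} κ(γ⁻¹)² e^{-2 π i (h' / (2 k) + m h / k)}`.
The sum runs over the reduced residue classes `u` modulo `k`; the integers `h = r u` and
`h' = r' u` represent `u` and satisfy `h h' ≡ -1 (mod k)`. -/
noncomputable def arithFactor (l : ℕ) [NeZero l] (m : ℤ)
    (r r' : (ZMod (2 * l))ˣ → ℤ)
    (hr' : ∀ u, ((2 * l : ℕ) : ℤ) ∣ r u * r' u + 1) : ℂ :=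
  -∑ u : (ZMod (2 * l))ˣ,
    thetaMultiplier (cuspMatrix l (r u) (r' u) (hr' u))⁻¹ ^ 2 *
      Complex.exp (-2 * Real.pi * Complex.I *
        ((r' u : ℂ) / (2 * ((2 * l : ℕ) : ℂ)) + (m : ℂ) * (r u : ℂ) / ((2 * l : ℕ) : ℂ)))

/-- The Kloosterman sum `T(a, b, l) = ∑_{(h, l) = 1} e^{2 π i (a h + b h̄) / l}`, where
`h h̄ ≡ 1 (mod l)`. -/
noncomputable def kloostermanSum (a b : ℤ) (l : ℕ) [NeZero l] : ℂ :=
  ∑ u : (ZMod l)ˣ,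
    Complex.exp (2 * Real.pi * Complex.I / (l : ℂ) *
      ((a : ℂ) * ((u : ZMod l).val : ℂ) + (b : ℂ) * (((u⁻¹ : (ZMod l)ˣ) : ZMod l).val : ℂ)))

/-! Squaring removes the square-root ambiguity: `SL(2, ℤ)` permutes θ₂², θ₃², θ₄² up to a power of i
and the factor cτ + d. The index and the power for θ₃² depend only on the matrix modulo 4, so
explicit formulas for them need only finite checks against right multiplication by T and S
(`thetaSqTransforms`). For a, c, d odd this gives κ² = i^d. A holomorphic square root on the
connected half-plane is determined up to sign, so κ exists; it is unique because θ₂(i) ≠ 0. With d =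
h' each summand of A_k(m) is an explicit root of unity. Since A inverts 2 modulo l and -h' inverts
h, it is a Kloosterman summand up to a constant sign, and reduction from 2l to l is bijective on
units. -/

/-! ### Squares of theta constants under T and S -/

open Complex in
/-- `θ₂` as a specialisation of the two-variable theta function. -/
theorem thetaTwo_eq_jacobiTheta₂ (τ : ℂ) :
    thetaTwo τ = exp (Real.pi * I * τ / 4) * jacobiTheta₂ (τ / 2) τ := by
  rw [← jacobiTheta₂_neg_left, thetaTwo, jacobiTheta₂, ← tsum_mul_left]
  refine tsum_congr fun n => ?_
  rw [jacobiTheta₂_term, ← exp_add]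
  congr 1
  ring

open Complex in
theorem jacobiTheta_add_one (τ : ℂ) : jacobiTheta (τ + 1) = jacobiTheta₂ (1 / 2) τ := by
  rw [jacobiTheta, jacobiTheta₂]
  refine tsum_congr fun n => ?_
  rw [jacobiTheta₂_term, exp_eq_exp_iff_exists_int]
  obtain ⟨k, hk⟩ : (2 : ℤ) ∣ n ^ 2 - n := by
    rw [show n ^ 2 - n = n * (n - 1) by ring]
    exact (Int.even_mul_pred_self n).two_dvd
  have hk' : (n : ℂ) ^ 2 - n = 2 * k := by exact_mod_cast hk
  refine ⟨k, ?_⟩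
  linear_combination (Real.pi * I) * hk'

open Complex in
theorem thetaTwo_add_one_sq (τ : ℂ) : thetaTwo (τ + 1) ^ 2 = I * thetaTwo τ ^ 2 := by
  have h : thetaTwo (τ + 1) = exp (Real.pi * I / 4) * thetaTwo τ := by
    rw [thetaTwo, thetaTwo, ← tsum_mul_left]
    refine tsum_congr fun n => ?_
    rw [← exp_add, exp_eq_exp_iff_exists_int]
    obtain ⟨k, hk⟩ : (2 : ℤ) ∣ n ^ 2 - n := by
      rw [show n ^ 2 - n = n * (n - 1) by ring]
      exact (Int.even_mul_pred_self n).two_dvd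
    have hk' : (n : ℂ) ^ 2 - n = 2 * k := by exact_mod_cast hk
    refine ⟨k, ?_⟩
    linear_combination (Real.pi * I) * hk'
  rw [h, mul_pow, ← exp_nat_mul, show ((2 : ℕ) : ℂ) * (Real.pi * I / 4) = Real.pi / 2 * I by
    push_cast; ring, exp_pi_div_two_mul_I]

theorem Complex.cpow_one_half_sq (z : ℂ) : (z ^ (1 / 2 : ℂ)) ^ 2 = z := by
  rw [one_div]
  exact_mod_cast Complex.cpow_nat_inv_pow z two_ne_zero

open Complex in
theorem jacobiTheta_neg_inv_sq {τ : ℂ} (hτ : 0 < τ.im) :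
    jacobiTheta (-1 / τ) ^ 2 = -I * τ * jacobiTheta τ ^ 2 := by
  have h0 : τ ≠ 0 := by rintro rfl; simp at hτ
  have h := congrArg (· ^ 2) (jacobiTheta₂_functional_equation 0 τ)
  simp only [mul_pow, div_pow, cpow_one_half_sq, zero_div, ← jacobiTheta_eq_jacobiTheta₂] at h
  rw [h]
  generalize jacobiTheta (-1 / τ) = x
  have : I ≠ 0 := I_ne_zero
  simp
  field_simp
  linear_combination x ^ 2 * I_sq

open Complex in
theorem jacobiTheta_neg_inv_add_one_sq {τ : ℂ} (hτ : 0 < τ.im) :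
    jacobiTheta (-1 / τ + 1) ^ 2 = -I * τ * thetaTwo τ ^ 2 := by
  have h0 : τ ≠ 0 := by rintro rfl; simp at hτ
  have h := congrArg (· ^ 2) (jacobiTheta₂_functional_equation (τ / 2) τ)
  rw [show τ / 2 / τ = 1 / 2 by field_simp] at h
  simp only [mul_pow, div_pow, cpow_one_half_sq, ← jacobiTheta_add_one] at h
  rw [thetaTwo_eq_jacobiTheta₂, mul_pow, h]
  have : I ≠ 0 := I_ne_zero
  have e : exp (Real.pi * I * τ / 4) ^ 2 * exp (-Real.pi * I * (τ ^ 2 / 2 ^ 2) / τ) ^ 2 = 1 := by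
    rw [← mul_pow, ← exp_add, show Real.pi * I * τ / 4 + -Real.pi * I * (τ ^ 2 / 2 ^ 2) / τ = 0 by
      field_simp; ring]
    simp
  clear h
  generalize exp (Real.pi * I * τ / 4) = x, exp (-Real.pi * I * (τ ^ 2 / 2 ^ 2) / τ) = y,
    jacobiTheta (-1 / τ + 1) = z at *
  field_simp
  linear_combination (-z ^ 2) * e

open Complex in
theorem thetaTwo_neg_inv_sq {τ : ℂ} (hτ : 0 < τ.im) :
    thetaTwo (-1 / τ) ^ 2 = -I * τ * jacobiTheta (τ + 1) ^ 2 := by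
  have h0 : τ ≠ 0 := by rintro rfl; simp at hτ
  have him : 0 < (-1 / τ).im := by
    rw [neg_div, neg_im, one_div, inv_im, neg_div, neg_neg]
    exact div_pos hτ (normSq_pos.2 h0)
  have h := jacobiTheta_neg_inv_add_one_sq him
  rw [show -1 / (-1 / τ) = τ by field_simp] at h
  rw [h]
  generalize thetaTwo (-1 / τ) = x
  field_simp
  linear_combination x ^ 2 * I_sq

/-- The theta constants `θ₂`, `θ₃`, `θ₄`, in this order. -/
noncomputable def thetaConst : Fin 3 → ℂ → ℂ :=
  ![thetaTwo, jacobiTheta, fun τ => jacobiTheta (τ + 1)]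

theorem thetaConst_add_one_sq (j : Fin 3) (τ : ℂ) :
    thetaConst j (τ + 1) ^ 2 =
      Complex.I ^ ((![1, 0, 0] : Fin 3 → ZMod 4) j).val *
        thetaConst ((![0, 2, 1] : Fin 3 → Fin 3) j) τ ^ 2 := by
  fin_cases j
  · have : (1 : ZMod 4).val = 1 := rfl
    simp [thetaConst, thetaTwo_add_one_sq, this]
  · simp [thetaConst]
  · have : τ + 1 + 1 = 2 + τ := by ring
    simp [thetaConst, this, jacobiTheta_two_add]

theorem thetaConst_neg_inv_sq (j : Fin 3) {τ : ℂ} (hτ : 0 < τ.im) :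
    thetaConst j (-1 / τ) ^ 2 =
      Complex.I ^ (3 : ZMod 4).val * τ * thetaConst ((![2, 1, 0] : Fin 3 → Fin 3) j) τ ^ 2 := by
  have : Complex.I ^ (3 : ZMod 4).val = -Complex.I := Complex.I_pow_three
  rw [this]
  fin_cases j
  · simpa [thetaConst] using thetaTwo_neg_inv_sq hτ
  · simpa [thetaConst] using jacobiTheta_neg_inv_sq hτ
  · simpa [thetaConst] using jacobiTheta_neg_inv_add_one_sq hτ

theorem Complex.I_pow_val_add (x y : ZMod 4) : I ^ (x + y).val = I ^ x.val * I ^ y.val := by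
  rw [ZMod.val_add, ← pow_add, ← pow_mod_orderOf, ← pow_mod_orderOf (n := x.val + y.val)]
  have : orderOf I ∣ 4 := orderOf_dvd_of_pow_eq_one I_pow_four
  rw [Nat.mod_mod_of_dvd _ this]

theorem Complex.I_pow_val_intCast (n : ℤ) : I ^ (n : ZMod 4).val = I ^ n := by
  rw [← zpow_natCast, ZMod.val_intCast]
  conv_rhs => rw [← Int.emod_add_mul_ediv n 4, zpow_add₀ I_ne_zero, zpow_mul]
  have : (I : ℂ) ^ (4 : ℤ) = 1 := I_pow_four
  simp [this]

/-! ### Index and exponent modulo 4 -/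

/-- The index of the theta constant to which `θ₃` is taken by a matrix with rows
`(a, b)`, `(c, d)` modulo `4`. -/
def thetaIndex (a b c d : ZMod 4) : Fin 3 :=
  if a ^ 2 * c ^ 2 = 1 then 0 else if b ^ 2 * d ^ 2 = 1 then 2 else 1

/-- The exponent of `i` in the transformation of `θ₃²` under a matrix with rows
`(a, b)`, `(c, d)` modulo `4`. -/
def thetaExponent (a b c d : ZMod 4) : ZMod 4 :=
  if a ^ 2 * c ^ 2 = 1 then c * d - c
  else if b ^ 2 * d ^ 2 = 1 then (d - c) ^ 3 - (d - c) ^ 2 - c ^ 3 else d ^ 3 - d ^ 2 - c ^ 3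

/-- Modulo 4, x² detects odd x and x³ is x for odd x and 0 for even x. The θ₄ exponent is the θ₃ one
with d replaced by d - c, because θ₄(τ) = θ₃(τ + 1). -/
theorem thetaIndex_mul_T : ∀ a b c d : ZMod 4, a * d - b * c = 1 →
    thetaIndex a (a + b) c (c + d) = (![0, 2, 1] : Fin 3 → Fin 3) (thetaIndex a b c d) := by
  decide

theorem thetaExponent_mul_T : ∀ a b c d : ZMod 4, a * d - b * c = 1 →
    thetaExponent a (a + b) c (c + d) =
      thetaExponent a b c d + (![1, 0, 0] : Fin 3 → ZMod 4) (thetaIndex a b c d) := by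
  decide

theorem thetaIndex_mul_S : ∀ a b c d : ZMod 4, a * d - b * c = 1 →
    thetaIndex b (-a) d (-c) = (![2, 1, 0] : Fin 3 → Fin 3) (thetaIndex a b c d) := by
  decide

theorem thetaExponent_mul_S : ∀ a b c d : ZMod 4, a * d - b * c = 1 →
    thetaExponent b (-a) d (-c) = thetaExponent a b c d + 3 := by
  decide

/-! ### Nonvanishing, holomorphy and square roots -/

open Complex in
theorem thetaTwo_I_ne_zero : thetaTwo I ≠ 0 := by
  have hs : Summable fun n : ℤ => exp (Real.pi * I * ((n : ℂ) - 1 / 2) ^ 2 * I) := by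
    have := ((summable_jacobiTheta₂_term_iff (-I / 2) I).2 (by simp)).mul_left
      (exp (Real.pi * I * I / 4))
    refine this.congr fun n => ?_
    rw [jacobiTheta₂_term, ← exp_add]
    congr 1
    ring
  -- At τ = i every term is a positive real.
  have he : ∀ n : ℤ, exp (Real.pi * I * ((n : ℂ) - 1 / 2) ^ 2 * I) =
      (Real.exp (-Real.pi * ((n : ℝ) - 1 / 2) ^ 2) : ℝ) := by
    intro n
    push_cast
    congr 1
    linear_combination (Real.pi * ((n : ℂ) - 1 / 2) ^ 2) * I_sq
  simp only [he, summable_ofReal] at hs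
  rw [thetaTwo]
  simp only [he]
  rw [← ofReal_tsum]
  exact ofReal_ne_zero.2 (hs.tsum_pos (fun _ => (Real.exp_pos _).le) 0 (Real.exp_pos _)).ne'

open Complex in
theorem differentiableAt_thetaTwo {τ : ℂ} (hτ : 0 < τ.im) : DifferentiableAt ℂ thetaTwo τ := by
  have h : DifferentiableAt ℂ (fun τ => exp (Real.pi * I * τ / 4) * jacobiTheta₂ (τ / 2) τ) τ := by
    refine .mul (by fun_prop) ?_
    exact (hasFDerivAt_jacobiTheta₂ (τ / 2) hτ).differentiableAt.comp
      (f := fun x : ℂ => (x / 2, x)) τ (by fun_prop)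
  exact h.congr_of_eventuallyEq (.of_forall thetaTwo_eq_jacobiTheta₂)

/-- With s² = C, the product (f - sg)(f + sg) vanishes, and analytic functions on a connected open
set have no zero divisors. -/
theorem DifferentiableOn.exists_eq_const_mul_of_sq_eq {U : Set ℂ} (hU : IsOpen U)
    (hU' : IsPreconnected U) {f g : ℂ → ℂ} (hf : DifferentiableOn ℂ f U)
    (hg : DifferentiableOn ℂ g U) {C : ℂ} (h : ∀ z ∈ U, f z ^ 2 = C * g z ^ 2) :
    ∃ κ : ℂ, κ ^ 2 = C ∧ ∀ z ∈ U, f z = κ * g z := by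
  set s := C ^ (1 / 2 : ℂ) with hs
  have hs : s ^ 2 = C := Complex.cpow_one_half_sq C
  have h1 := (hf.sub (hg.const_mul s)).analyticOnNhd hU
  have h2 := (hf.add (hg.const_mul s)).analyticOnNhd hU
  rcases AnalyticOnNhd.eq_zero_or_eq_zero_of_smul_eq_zero h1 h2 (fun z hz => by
    have := h z hz
    simp only [Pi.sub_apply, Pi.add_apply, smul_eq_mul]
    linear_combination this - g z ^ 2 * hs) hU' with h | h
  · exact ⟨s, hs, fun z hz => sub_eq_zero.1 (h z hz)⟩
  · exact ⟨-s, by rw [neg_sq, hs], fun z hz => by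
      have := h z hz
      simp only [Pi.add_apply] at this
      linear_combination this⟩

/-! ### Transformation of θ₃² under `SL(2, ℤ)` -/

section UpperHalfPlane

open UpperHalfPlane ModularGroup

theorem Matrix.SpecialLinearGroup.det_intCast_zmod_four (M : SL(2, ℤ)) :
    ((M 0 0 : ℤ) : ZMod 4) * ((M 1 1 : ℤ) : ZMod 4) -
      ((M 0 1 : ℤ) : ZMod 4) * ((M 1 0 : ℤ) : ZMod 4) = 1 := by
  have h := M.det_coe
  rw [Matrix.det_fin_two] at h
  exact_mod_cast congrArg (Int.cast : ℤ → ZMod 4) h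

/-- The transformation law of `θ₃²` under `M`. -/
def ThetaSqTransforms (M : SL(2, ℤ)) : Prop :=
  ∀ τ : ℍ, jacobiTheta ((M • τ : ℍ) : ℂ) ^ 2 =
    Complex.I ^ (thetaExponent (M 0 0 : ℤ) (M 0 1 : ℤ) (M 1 0 : ℤ) (M 1 1 : ℤ)).val *
      (((M 1 0 : ℤ) : ℂ) * τ + ((M 1 1 : ℤ) : ℂ)) *
        thetaConst (thetaIndex (M 0 0 : ℤ) (M 0 1 : ℤ) (M 1 0 : ℤ) (M 1 1 : ℤ)) τ ^ 2

theorem thetaSqTransforms_one : ThetaSqTransforms 1 := by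
  intro τ
  have h1 : thetaIndex 1 0 0 1 = 1 := by decide
  have h2 : thetaExponent 1 0 0 1 = 0 := by decide
  simp [h1, h2, thetaConst]

theorem ThetaSqTransforms.mul_T {M : SL(2, ℤ)} (h : ThetaSqTransforms M) :
    ThetaSqTransforms (M * T) := by
  intro τ
  have hd := M.det_intCast_zmod_four
  have e00 : (M * T) 0 0 = M 0 0 := by
    simp [Matrix.SpecialLinearGroup.coe_mul, coe_T, Matrix.mul_apply, Fin.sum_univ_two]
  have e01 : (M * T) 0 1 = M 0 0 + M 0 1 := by
    simp [Matrix.SpecialLinearGroup.coe_mul, coe_T, Matrix.mul_apply, Fin.sum_univ_two]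
  have e10 : (M * T) 1 0 = M 1 0 := by
    simp [Matrix.SpecialLinearGroup.coe_mul, coe_T, Matrix.mul_apply, Fin.sum_univ_two]
  have e11 : (M * T) 1 1 = M 1 0 + M 1 1 := by
    simp [Matrix.SpecialLinearGroup.coe_mul, coe_T, Matrix.mul_apply, Fin.sum_univ_two]
  have hT : ((T • τ : ℍ) : ℂ) = τ + 1 := by
    rw [modular_T_smul, coe_vadd, add_comm]; simp
  rw [mul_smul, h, hT, thetaConst_add_one_sq, e00, e01, e10, e11]
  push_cast
  rw [thetaIndex_mul_T _ _ _ _ hd, thetaExponent_mul_T _ _ _ _ hd, Complex.I_pow_val_add]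
  ring

theorem ThetaSqTransforms.mul_S {M : SL(2, ℤ)} (h : ThetaSqTransforms M) :
    ThetaSqTransforms (M * S) := by
  intro τ
  have hd := M.det_intCast_zmod_four
  have e00 : (M * S) 0 0 = M 0 1 := by
    simp [Matrix.SpecialLinearGroup.coe_mul, coe_S, Matrix.mul_apply, Fin.sum_univ_two]
  have e01 : (M * S) 0 1 = -M 0 0 := by
    simp [Matrix.SpecialLinearGroup.coe_mul, coe_S, Matrix.mul_apply, Fin.sum_univ_two]
  have e10 : (M * S) 1 0 = M 1 1 := by
    simp [Matrix.SpecialLinearGroup.coe_mul, coe_S, Matrix.mul_apply, Fin.sum_univ_two]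
  have e11 : (M * S) 1 1 = -M 1 0 := by
    simp [Matrix.SpecialLinearGroup.coe_mul, coe_S, Matrix.mul_apply, Fin.sum_univ_two]
  have hS : ((S • τ : ℍ) : ℂ) = -1 / τ := by
    rw [modular_S_smul]; simp [inv_neg, neg_div]
  have h0 : (τ : ℂ) ≠ 0 := τ.ne_zero
  rw [mul_smul, h, hS, thetaConst_neg_inv_sq _ τ.im_pos, e00, e01, e10, e11]
  push_cast
  rw [thetaIndex_mul_S _ _ _ _ hd, thetaExponent_mul_S _ _ _ _ hd, Complex.I_pow_val_add]
  field_simp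
  ring

theorem thetaSqTransforms (M : SL(2, ℤ)) : ThetaSqTransforms M := by
  have hM : M ∈ Subgroup.closure {S, T} := by
    rw [SpecialLinearGroup.SL2Z_generators]; trivial
  -- Inverses of the generators are positive words, so `mul_S` and `mul_T` suffice.
  have hS : S⁻¹ = S * S * S := by decide
  have hT : T⁻¹ = S * S * S * T * S * T * S := by decide
  induction hM using Subgroup.closure_induction_right with
  | one => exact thetaSqTransforms_one
  | mul_right M _ y hy h =>
    rcases hy with rfl | rfl
    exacts [h.mul_S, h.mul_T]
  | mul_inv_cancel M _ y hy h =>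
    rcases hy with rfl | rfl
    · simpa only [hS, ← mul_assoc] using h.mul_S.mul_S.mul_S
    · simpa only [hT, ← mul_assoc] using h.mul_S.mul_S.mul_S.mul_T.mul_S.mul_T.mul_S

theorem jacobiTheta_smul_sq {M : SL(2, ℤ)} (ha : Odd (M 0 0)) (hc : Odd (M 1 0))
    (hd : Odd (M 1 1)) (τ : ℍ) :
    jacobiTheta ((M • τ : ℍ) : ℂ) ^ 2 =
      Complex.I ^ (M 1 1) / Complex.I * (((M 1 0 : ℤ) : ℂ) * τ + ((M 1 1 : ℤ) : ℂ)) *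
        thetaTwo τ ^ 2 := by
  have key : ∀ a b c d : ZMod 4, thetaIndex (2 * a + 1) b (2 * c + 1) (2 * d + 1) = 0 ∧
      thetaExponent (2 * a + 1) b (2 * c + 1) (2 * d + 1) = 2 * d := by decide
  have h := thetaSqTransforms M τ
  obtain ⟨a, ha⟩ := ha
  obtain ⟨c, hc⟩ := hc
  obtain ⟨d, hd⟩ := hd
  have k := key a (M 0 1 : ℤ) c d
  have e : Complex.I ^ (M 1 1) / Complex.I = Complex.I ^ (2 * (d : ZMod 4)).val := by
    rw [hd, zpow_add_one₀ Complex.I_ne_zero, mul_div_cancel_right₀ _ Complex.I_ne_zero,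
      ← Complex.I_pow_val_intCast]
    push_cast
    rfl
  have ha' := congrArg (Int.cast : ℤ → ZMod 4) ha
  have hc' := congrArg (Int.cast : ℤ → ZMod 4) hc
  have hd' := congrArg (Int.cast : ℤ → ZMod 4) hd
  push_cast at ha' hc' hd'
  rw [← ha', ← hc', ← hd'] at k
  rw [e, h, k.1, k.2]
  rfl

/-! ### The multiplier κ and its square -/

section
variable {M : SL(2, ℤ)}

theorem intCast_mul_I_add_intCast_ne_zero (M : SL(2, ℤ)) :
    (((M 1 0 : ℤ) : ℂ) * (I : ℍ) + ((M 1 1 : ℤ) : ℂ)) ≠ 0 := by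
  have := denom_ne_zero (M : GL (Fin 2) ℝ) I
  simpa [denom] using this

theorem IsThetaMultiplier.unique {κ κ' : ℂ} (h : IsThetaMultiplier M κ)
    (h' : IsThetaMultiplier M κ') : κ = κ' := by
  have e := (h I).symm.trans (h' I)
  have h1 := intCast_mul_I_add_intCast_ne_zero M
  have h2 : thetaTwo ((I : ℍ) : ℂ) ≠ 0 := thetaTwo_I_ne_zero
  refine mul_right_cancel₀ ?_ (mul_right_cancel₀ h2 e)
  refine div_ne_zero ?_ ?_ <;> rw [Ne, Complex.cpow_eq_zero_iff]
  · exact fun h => h1 h.1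
  · exact fun h => Complex.I_ne_zero h.1

theorem IsThetaMultiplier.sq {κ : ℂ} (h : IsThetaMultiplier M κ) (ha : Odd (M 0 0))
    (hc : Odd (M 1 0)) (hd : Odd (M 1 1)) : κ ^ 2 = Complex.I ^ (M 1 1) := by
  have e := congrArg (· ^ 2) (h I)
  simp only [mul_pow, div_pow, Complex.cpow_one_half_sq, jacobiTheta_smul_sq ha hc hd] at e
  have h1 := intCast_mul_I_add_intCast_ne_zero M
  have h2 : thetaTwo ((I : ℍ) : ℂ) ^ 2 ≠ 0 := pow_ne_zero 2 thetaTwo_I_ne_zero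
  have e := mul_right_cancel₀ h2 e
  rw [div_mul_eq_mul_div, ← mul_div_assoc] at e
  exact (mul_right_cancel₀ h1 ((div_left_inj' Complex.I_ne_zero).1 e)).symm

theorem exists_isThetaMultiplier (ha : Odd (M 0 0)) (hc : Odd (M 1 0)) (hd : Odd (M 1 1)) :
    ∃ κ, IsThetaMultiplier M κ := by
  -- As c ≠ 0, cτ + d is never real, so its principal root is holomorphic.
  have hc0 : (M 1 0 : ℤ) ≠ 0 := by rintro h; simp [h] at hc
  have hsl : ∀ z : ℂ, 0 < z.im →
      ((M 1 0 : ℤ) : ℂ) * z + ((M 1 1 : ℤ) : ℂ) ∈ Complex.slitPlane := fun z hz => by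
    refine Complex.mem_slitPlane_iff.2 (.inr ?_)
    simp [hc0, hz.ne']
  have hcoe : ∀ z (hz : 0 < z.im), ((M • (⟨z, hz⟩ : ℍ) : ℍ) : ℂ) =
      (((M 0 0 : ℤ) : ℂ) * z + ((M 0 1 : ℤ) : ℂ)) / (((M 1 0 : ℤ) : ℂ) * z + ((M 1 1 : ℤ) : ℂ)) :=
    fun z hz => by rw [coe_specialLinearGroup_apply]; simp
  obtain ⟨κ, -, h⟩ := DifferentiableOn.exists_eq_const_mul_of_sq_eq
    (U := {z : ℂ | 0 < z.im}) (C := Complex.I ^ (M 1 1))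
    (f := fun z => jacobiTheta ((((M 0 0 : ℤ) : ℂ) * z + ((M 0 1 : ℤ) : ℂ)) /
      (((M 1 0 : ℤ) : ℂ) * z + ((M 1 1 : ℤ) : ℂ))))
    (g := fun z => (((M 1 0 : ℤ) : ℂ) * z + ((M 1 1 : ℤ) : ℂ)) ^ (1 / 2 : ℂ) /
      Complex.I ^ (1 / 2 : ℂ) * thetaTwo z)
    (isOpen_lt continuous_const Complex.continuous_im)
    (convex_halfSpace_im_gt 0).isPreconnected
    (fun z hz => by
      have := differentiableAt_jacobiTheta (M • (⟨z, hz⟩ : ℍ) : ℍ).coe_im_pos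
      rw [hcoe] at this
      refine (this.comp (f := fun z : ℂ => (((M 0 0 : ℤ) : ℂ) * z + ((M 0 1 : ℤ) : ℂ)) /
        (((M 1 0 : ℤ) : ℂ) * z + ((M 1 1 : ℤ) : ℂ))) z ?_).differentiableWithinAt
      have := Complex.slitPlane_ne_zero (hsl z hz)
      fun_prop (disch := assumption))
    (fun z hz => by
      refine DifferentiableAt.differentiableWithinAt (.mul (.div_const ?_ _) ?_)
      · exact DifferentiableAt.cpow_const (by fun_prop) (hsl z hz)
      · exact differentiableAt_thetaTwo hz)
    (fun z hz => by
      have := jacobiTheta_smul_sq ha hc hd ⟨z, hz⟩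
      rw [hcoe] at this
      simp only [mul_pow, div_pow, Complex.cpow_one_half_sq, this]
      ring)
  refine ⟨κ, fun τ => ?_⟩
  have := h τ τ.im_pos
  rw [← hcoe _ τ.im_pos] at this
  rw [mul_assoc]
  exact this

end

theorem thetaMultiplier_sq {M : SL(2, ℤ)} (ha : Odd (M 0 0)) (hc : Odd (M 1 0))
    (hd : Odd (M 1 1)) : thetaMultiplier M ^ 2 = Complex.I ^ (M 1 1) :=
  (Classical.epsilon_spec (exists_isThetaMultiplier ha hc hd)).sq ha hc hd

end UpperHalfPlane

/-! ### Comparison with the Kloosterman sum -/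

theorem cuspMatrix_inv_apply (l : ℕ) (h h' : ℤ) (hh : ((2 * l : ℕ) : ℤ) ∣ h * h' + 1) :
    (cuspMatrix l h h' hh)⁻¹ 0 0 = -h ∧ (cuspMatrix l h h' hh)⁻¹ 1 0 = -l ∧
      (cuspMatrix l h h' hh)⁻¹ 1 1 = h' := by
  rw [Matrix.SpecialLinearGroup.SL2_inv_expl]
  simp [cuspMatrix]

theorem odd_of_two_mul_dvd_mul_add_one {l : ℕ} {h h' : ℤ}
    (hh : ((2 * l : ℕ) : ℤ) ∣ h * h' + 1) : Odd h ∧ Odd h' := by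
  obtain ⟨c, hc⟩ := hh
  rw [← Int.odd_mul]
  exact ⟨l * c - 1, by push_cast at hc; linarith⟩

open Complex in
theorem neg_I_zpow_mul_exp_eq {n : ℕ} {h h' : ℤ} (ho : Odd h) (ho' : Odd h') (m : ℤ) {x y : ℤ}
    (hx : ((2 * n + 1 : ℕ) : ℤ) ∣ x - h) (hy : ((2 * n + 1 : ℕ) : ℤ) ∣ y + h') :
    -(I ^ h' * exp (-2 * Real.pi * I *
        ((h' : ℂ) / (2 * ((2 * (2 * n + 1) : ℕ) : ℂ)) +
          (m : ℂ) * (h : ℂ) / ((2 * (2 * n + 1) : ℕ) : ℂ)))) =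
      (-1 : ℂ) ^ n * (-1 : ℂ) ^ (m - 1) *
        exp (2 * Real.pi * I / ((2 * n + 1 : ℕ) : ℂ) *
          (((-2 * m * ((n : ℤ) + 1) ^ 2 : ℤ) : ℂ) * (x : ℂ) +
            ((((n : ℤ) + 1) ^ 2 : ℤ) : ℂ) * (y : ℂ))) := by
  obtain ⟨p, rfl⟩ := ho
  obtain ⟨s, rfl⟩ := ho'
  obtain ⟨u, hu⟩ := hx
  obtain ⟨v, hv⟩ := hy
  obtain rfl : x = 2 * p + 1 + (2 * n + 1 : ℕ) * u := by linarith
  obtain rfl : y = -(2 * s + 1) + (2 * n + 1 : ℕ) * v := by linarith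
  have hl : (2 * (n : ℂ) + 1) ≠ 0 := by exact_mod_cast Nat.succ_ne_zero (2 * n)
  have hI : I ^ (2 * s + 1) = exp ((2 * s + 1 : ℤ) * (Real.pi / 2 * I)) := by
    rw [exp_int_mul, exp_pi_div_two_mul_I]
  rw [hI, neg_eq_neg_one_mul, ← exp_pi_mul_I, ← exp_nat_mul, ← exp_int_mul, ← exp_add, ← exp_add, ← exp_add, ← exp_add, exp_eq_exp_iff_exists_int]
  -- The difference of the exponents over 2πi, with l = 2n + 1 and A = n + 1: it is an integer
  -- because 4A² - 1 = l(l + 2). The terms in u and v account for replacing h, -h' by x, y.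
  refine ⟨2 + s * (n + 2) + m * (p * (2 * n + 3) + n + 1) -
    (-2 * m * (n + 1) ^ 2 * u + (n + 1) ^ 2 * v), ?_⟩
  push_cast
  field_simp
  ring

theorem arithFactor_eq_kloostermanSum (l : ℕ) [NeZero l] (hl : Odd l) (m : ℤ)
    (r r' : (ZMod (2 * l))ˣ → ℤ)
    (hr : ∀ u, ((r u : ℤ) : ZMod (2 * l)) = (u : ZMod (2 * l)))
    (hr' : ∀ u, ((2 * l : ℕ) : ℤ) ∣ r u * r' u + 1) :
    arithFactor l m r r' hr' =
      (-1 : ℂ) ^ ((l - 1) / 2) * (-1 : ℂ) ^ (m - 1) *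
        kloostermanSum (-2 * m * (((l : ℤ) + 1) / 2) ^ 2) ((((l : ℤ) + 1) / 2) ^ 2) l := by
  have hdvd : l ∣ 2 * l := dvd_mul_left l 2
  -- For odd l, φ(2l) = φ(l), so the surjection on units is bijective.
  have hbij : Function.Bijective (ZMod.unitsMap hdvd) := by
    refine (Fintype.bijective_iff_surjective_and_card _).2 ⟨ZMod.unitsMap_surjective hdvd, ?_⟩
    rw [ZMod.card_units_eq_totient, ZMod.card_units_eq_totient,
      Nat.totient_mul (Nat.coprime_two_left.2 hl), Nat.totient_two, one_mul]
  rw [arithFactor, kloostermanSum, ← Finset.sum_neg_distrib, Finset.mul_sum]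
  refine Fintype.sum_bijective _ hbij _ _ fun u => ?_
  obtain ⟨ho, ho'⟩ := odd_of_two_mul_dvd_mul_add_one (hr' u)
  obtain ⟨h00, h10, h11⟩ := cuspMatrix_inv_apply l (r u) (r' u) (hr' u)
  rw [thetaMultiplier_sq (by rw [h00]; exact ho.neg)
    (by rw [h10]; exact ((Int.odd_coe_nat l).2 hl).neg) (by rw [h11]; exact ho'), h11]
  set v := ZMod.unitsMap hdvd u with hv
  have hvr : (v : ZMod l) = ((r u : ℤ) : ZMod l) := by
    have := congrArg (ZMod.castHom hdvd (ZMod l)) (hr u)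
    rw [map_intCast] at this
    exact this.symm
  have hvr' : ((v⁻¹ : (ZMod l)ˣ) : ZMod l) = -((r' u : ℤ) : ZMod l) := by
    have h := (ZMod.intCast_zmod_eq_zero_iff_dvd _ _).2
      ((Int.natCast_dvd_natCast.2 hdvd).trans (hr' u))
    push_cast at h
    rw [← hvr] at h
    refine Units.inv_eq_of_mul_eq_one_right ?_
    linear_combination -h
  have hx : (l : ℤ) ∣ ((v : ZMod l).val : ℤ) - r u := by
    rw [← ZMod.intCast_zmod_eq_zero_iff_dvd]
    simp [hvr]
  have hy : (l : ℤ) ∣ (((v⁻¹ : (ZMod l)ˣ) : ZMod l).val : ℤ) + r' u := by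
    rw [← ZMod.intCast_zmod_eq_zero_iff_dvd]
    push_cast
    rw [ZMod.natCast_zmod_val, hvr', neg_add_cancel]
  clear_value v
  obtain ⟨n, rfl⟩ := hl
  have h1 : (2 * n + 1 - 1) / 2 = n := by omega
  have h2 : (((2 * n + 1 : ℕ) : ℤ) + 1) / 2 = n + 1 := by omega
  rw [h1, h2]
  exact_mod_cast neg_I_zpow_mul_exp_eq ho ho' m hx hy

theorem mainTheorem7 (l : ℕ) [NeZero l] (hl : Odd l) (m : ℤ)
    (r r' : (ZMod (2 * l))ˣ → ℤ)
    (hr : ∀ u, ((r u : ℤ) : ZMod (2 * l)) = (u : ZMod (2 * l)))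
    (hr' : ∀ u, ((2 * l : ℕ) : ℤ) ∣ r u * r' u + 1) :
    (∀ u, ∃! κ : ℂ, IsThetaMultiplier (cuspMatrix l (r u) (r' u) (hr' u))⁻¹ κ) ∧
    arithFactor l m r r' hr' =
      (-1 : ℂ) ^ ((l - 1) / 2) * (-1 : ℂ) ^ (m - 1) *
        kloostermanSum (-2 * m * (((l : ℤ) + 1) / 2) ^ 2) ((((l : ℤ) + 1) / 2) ^ 2) l := by
  refine ⟨fun u => ?_, arithFactor_eq_kloostermanSum l hl m r r' hr hr'⟩
  obtain ⟨ho, ho'⟩ := odd_of_two_mul_dvd_mul_add_one (hr' u)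
  obtain ⟨h00, h10, h11⟩ := cuspMatrix_inv_apply l (r u) (r' u) (hr' u)
  obtain ⟨κ, hκ⟩ := exists_isThetaMultiplier (by rw [h00]; exact ho.neg)
    (by rw [h10]; exact ((Int.odd_coe_nat l).2 hl).neg) (by rw [h11]; exact ho')
  exact ⟨κ, hκ, fun _ h => h.unique hκ⟩
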